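/- For a permutation group $G\le S_n$ let $P(G)\subset \mathrm{Mat}_n(\mathbb R)$ be the convex hull of the permutation matrices of the elements of $G$. Let $\Delta_m\subset\mathbb R^{m+1}$ be the convex hull of the standard basis vectors (the unimodular $m$-simplex). Two polytopes $P, Q$ in real vector spaces with lattices $L, M$ are lattice equivalent if there is an affine isomorphism $\mathrm{aff}(P)\to\mathrm{aff}(Q)$ mapping $P$ onto $Q$ and $\mathrm{aff}(P)\cap L$ onto $\mathrm{aff}(Q)\cap M$. A polytope $P$ lying in an affine hyperplane not containing the origin is the $\mathbb Z$-join (with respect to a lattice $L$) of polytopes $P_1,\dots,P_s$ if $P=\mathrm{conv}(P_1\cup\dots\cup P_s)$, $\mathrm{lin}(P)=\bigoplus_{i}\mathrm{lin}(P_i)$ and $\mathrm{lin}(P)\cap L=\bigoplus_i(\mathrm{lin}(P_i)\cap L)$; it is the $s$-fold $\mathbb Z$-join of $R$ if moreover every $P_i$ is lattice equivalent to $R$. Let $G=\langle g\rangle\le S_n$, where $g$ is a product of two disjoint cycles of lengths $\ell_1,\ell_2\ge 1$ (and fixes all points outside these two cycles), and let $q=\gcd(\ell_1,\ell_2)$.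 Then, with respect to the lattice $\mathrm{Mat}_n(\mathbb Z)$, $P(G)$ is the $q$-fold $\mathbb Z$-join of $$\Delta_{\ell_1/q-1}\times\Delta_{\ell_2/q-1}\subset\mathbb R^{\ell_1/q}\times\mathbb R^{\ell_2/q},$$ where the product carries the lattice $\mathbb Z^{\ell_1/q}\times\mathbb Z^{\ell_2/q}$. In particular, $P(G)$ has dimension $\ell_1+\ell_2-q-1$ and $\mathrm{lcm}(\ell_1,\ell_2)$ vertices. If neither of $\ell_1,\ell_2$ divides the other, it has $\ell_1+\ell_2$ facets; if one divides the other, it has $\max(\ell_1,\ell_2)$ facets (faces of dimension $\dim P(G)-1$, where the empty face has dimension $-1$). -/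

import Mathlib

/-- The permutation polytope `P(G)` of a permutation group `G ≤ S_n`: the convex hull of the
permutation matrices of the elements of `G`. (Mathlib's `permMatrix σ` may be the transpose of the
matrix with `e_j ↦ e_{σ j}`, i.e. the matrix of `σ⁻¹`; the set of matrices of a subgroup is the
same for both conventions.) -/
noncomputable def permutationPolytope {n : ℕ} (G : Subgroup (Equiv.Perm (Fin n))) :
    Set (Matrix (Fin n) (Fin n) ℝ) :=
  convexHull ℝ ((fun σ : Equiv.Perm (Fin n) => σ.permMatrix ℝ) '' (G : Set (Equiv.Perm (Fin n))))

/-- The lattice `ℤ^ι` in `ℝ^ι`. -/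
def integerLattice (ι : Type*) : AddSubgroup (ι → ℝ) where
  carrier := {x | ∀ i, ∃ z : ℤ, x i = z}
  zero_mem' := fun _ => ⟨0, by simp⟩
  add_mem' := by
    intro x y hx hy i
    obtain ⟨a, ha⟩ := hx i
    obtain ⟨b, hb⟩ := hy i
    exact ⟨a + b, by simp [ha, hb]⟩
  neg_mem' := by
    intro x hx i
    obtain ⟨a, ha⟩ := hx i
    exact ⟨-a, by simp [ha]⟩

/-- The lattice `Mat_n(ℤ)` in `Mat_n(ℝ)`. -/
def integerMatrices (n : ℕ) : AddSubgroup (Matrix (Fin n) (Fin n) ℝ) where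
  carrier := {M | ∀ i j, ∃ z : ℤ, M i j = z}
  zero_mem' := fun _ _ => ⟨0, by simp⟩
  add_mem' := by
    intro x y hx hy i j
    obtain ⟨a, ha⟩ := hx i j
    obtain ⟨b, hb⟩ := hy i j
    exact ⟨a + b, by simp [ha, hb]⟩
  neg_mem' := by
    intro x hx i j
    obtain ⟨a, ha⟩ := hx i j
    exact ⟨-a, by simp [ha]⟩

/-- The unimodular `m`-simplex: the convex hull of the standard basis vectors of `ℝ^(m+1)`. -/
def unimodularSimplex (m : ℕ) : Set (Fin (m + 1) → ℝ) :=
  stdSimplex ℝ (Fin (m + 1))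

section Polytopes

variable {V W : Type*} [AddCommGroup V] [Module ℝ V] [AddCommGroup W] [Module ℝ W]

/-- A (non-empty) polytope: the convex hull of a non-empty finite set. -/
def IsPolytope (P : Set V) : Prop :=
  ∃ s : Set V, s.Finite ∧ s.Nonempty ∧ P = convexHull ℝ s

/-- `P` (with respect to the lattice `L`) and `Q` (with respect to the lattice `M`) are lattice
equivalent: there is an affine isomorphism of `aff P` onto `aff Q` which maps `P` onto `Q` and the
lattice points of `aff P` onto the lattice points of `aff Q`. (Every affine map on the affine
subspace `aff P` extends to `V`, and `f '' P = Q` forces `f` to map `aff P` onto `aff Q`.) -/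
def LatticeEquivalent (L : AddSubgroup V) (P : Set V) (M : AddSubgroup W) (Q : Set W) : Prop :=
  ∃ f : V →ᵃ[ℝ] W,
    Set.InjOn f (affineSpan ℝ P : Set V) ∧
    f '' P = Q ∧
    f '' ((affineSpan ℝ P : Set V) ∩ (L : Set V)) = (affineSpan ℝ Q : Set W) ∩ (M : Set W)

/-- `P` is the join of the polytopes `Q 0, …, Q (s-1)`: `P` lies in an affine hyperplane (not
containing the origin), `P` is the convex hull of the `Q i`, and the linear span of `P` is the
internal direct sum of the linear spans of the `Q i`. -/
structure IsJoin {s : ℕ} (P : Set V) (Q : Fin s → Set V) : Prop where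
  isPolytope : ∀ i, IsPolytope (Q i)
  hyperplane : ∃ f : V →ₗ[ℝ] ℝ, ∀ x ∈ P, f x = 1
  convexHull_eq : P = convexHull ℝ (⋃ i, Q i)
  span_eq : Submodule.span ℝ P = ⨆ i, Submodule.span ℝ (Q i)
  independent : iSupIndep fun i => Submodule.span ℝ (Q i)

/-- `P` is the `ℤ`-join of the `Q i` with respect to the lattice `L`: it is their join and
`lin P ∩ L` is the direct sum of the groups `lin (Q i) ∩ L`
(that this sum is direct follows from `independent`). -/
structure IsZJoin {s : ℕ} (L : AddSubgroup V) (P : Set V) (Q : Fin s → Set V) : Prop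
    extends IsJoin P Q where
  lattice_eq : (Submodule.span ℝ P).toAddSubgroup ⊓ L =
    ⨆ i, (Submodule.span ℝ (Q i)).toAddSubgroup ⊓ L

/-- `P` is the `s`-fold `ℤ`-join of `R`: it is the `ℤ`-join of `s` polytopes, each of which is
lattice equivalent to `R`. -/
def IsFoldZJoin (s : ℕ) (L : AddSubgroup V) (P : Set V) (M : AddSubgroup W) (R : Set W) : Prop :=
  ∃ Q : Fin s → Set V, IsZJoin L P Q ∧ ∀ i, LatticeEquivalent L (Q i) M R

open Classical in
/-- The dimension of a polytope or of a face: the dimension of its affine hull, `-1` for `∅`. -/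
noncomputable def polytopeDim (P : Set V) : ℤ :=
  if P = ∅ then -1 else (Module.finrank ℝ (vectorSpan ℝ P) : ℤ)

/-- A facet of a polytope `P`: a face of dimension `dim P - 1`. (`IsExposed ℝ P F` says that `F` is
empty or the set where some linear functional attains its maximum over `P`. In particular the only
facet of a point is its empty face.) -/
def IsFacet [TopologicalSpace V] (P F : Set V) : Prop :=
  IsExposed ℝ P F ∧ polytopeDim F = polytopeDim P - 1

end Polytopes

/-! Write `ℓ₁ = q * m` and `ℓ₂ = q * k`. On the first cycle `g ^ N` depends only on `N` mod `q * m`,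
on the second only on `N` mod `q * k`. Writing these residues as `r + q * i` and `r + q * j`, with
the same `r = N % q`, splits the matrix of `g ^ N` by rows into `A r i + B r j`. By the Chinese
remainder theorem every triple `(r, i, j)` occurs (`permutationPolytope_eq_twoCycleFrame`). Single
matrix entries, integral on the lattice, form a dual system to the `A r i` and `B r j`.

Everything else follows from this biorthogonal system. For fixed `r` the points `A r i + B r j` span
a product of two simplices; distinct `r` use disjoint sets of coordinates, so the polytope is a
join, and integrality of the coordinates makes it a `ℤ`-join. By `mem_polytope_iff` the polytope is
cut out by nonnegative coordinates, one balance equation per `r`, and total height 1, so its span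
has dimension `q * m + q * k - q`.

Every facet is a set where one coordinate vanishes (`exists_subset_face`, `eq_face_of_subset`). If
both simplices have positive dimension, all coordinates give distinct facets. If one is a point, its
coordinate in a block is the sum of the coordinates of the other kind, and only the latter are
needed. -/

open Module

/-! ### Biorthogonal frames and the inequality description of their polytopes -/

/-- A biorthogonal system in `V` indexed by `ρ × α ⊕ ρ × β`. -/
structure JoinFrame (V ρ α β : Type*) [AddCommGroup V] [Module ℝ V] [TopologicalSpace V]
    [DecidableEq ρ] [DecidableEq α] [DecidableEq β] where
  A : ρ → α → V
  B : ρ → β → V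
  X : ρ → α → StrongDual ℝ V
  Y : ρ → β → StrongDual ℝ V
  X_A : ∀ r i r' i', X r i (A r' i') = if r = r' then (if i = i' then 1 else 0) else 0
  X_B : ∀ r i r' j, X r i (B r' j) = 0
  Y_A : ∀ r j r' i, Y r j (A r' i) = 0
  Y_B : ∀ r j r' j', Y r j (B r' j') = if r = r' then (if j = j' then 1 else 0) else 0

namespace JoinFrame

variable {V ρ α β : Type*} [AddCommGroup V] [Module ℝ V] [TopologicalSpace V]
  [DecidableEq ρ] [DecidableEq α] [DecidableEq β]

/-- The frame with the roles of the two factors exchanged. -/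
def swap (F : JoinFrame V ρ α β) : JoinFrame V ρ β α where
  A := F.B
  B := F.A
  X := F.Y
  Y := F.X
  X_A := F.Y_B
  X_B := F.Y_A
  Y_A := F.X_B
  Y_B := F.X_A

/-- The vertices of the join. -/
def vertex (F : JoinFrame V ρ α β) (t : ρ × α × β) : V := F.A t.1 t.2.1 + F.B t.1 t.2.2

/-- The convex hull of all vertices. -/
def polytope (F : JoinFrame V ρ α β) : Set V := convexHull ℝ (Set.range F.vertex)

/-- The convex hull of the vertices with a given first index. -/
def component (F : JoinFrame V ρ α β) (r : ρ) : Set V :=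
  convexHull ℝ (Set.range fun t : α × β => F.vertex (r, t))

lemma swap_polytope (F : JoinFrame V ρ α β) : F.swap.polytope = F.polytope := by
  unfold polytope
  congr 1
  ext v
  constructor
  · rintro ⟨⟨r, i, j⟩, rfl⟩
    exact ⟨(r, j, i), add_comm _ _⟩
  · rintro ⟨⟨r, i, j⟩, rfl⟩
    exact ⟨(r, j, i), add_comm _ _⟩

@[simp] lemma X_vertex (F : JoinFrame V ρ α β) (r : ρ) (i : α) (t : ρ × α × β) :
    F.X r i (F.vertex t) = if r = t.1 then (if i = t.2.1 then 1 else 0) else 0 := by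
  simp [vertex, F.X_A, F.X_B]

@[simp] lemma Y_vertex (F : JoinFrame V ρ α β) (r : ρ) (j : β) (t : ρ × α × β) :
    F.Y r j (F.vertex t) = if r = t.1 then (if j = t.2.2 then 1 else 0) else 0 := by
  simp [vertex, F.Y_A, F.Y_B]

lemma vertex_mem (F : JoinFrame V ρ α β) (t : ρ × α × β) : F.vertex t ∈ F.polytope :=
  subset_convexHull _ _ ⟨t, rfl⟩

lemma vertex_injective (F : JoinFrame V ρ α β) : Function.Injective F.vertex := by
  rintro ⟨r, i, j⟩ ⟨r', i', j'⟩ h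
  have h1 := congrArg (F.X r i) h
  have h2 := congrArg (F.Y r j) h
  simp only [X_vertex, Y_vertex, if_true] at h1 h2
  split_ifs at h1 h2 <;> simp_all

lemma swap_mem (F : JoinFrame V ρ α β) {p : V} : p ∈ F.swap.polytope ↔ p ∈ F.polytope := by
  rw [swap_polytope]

/-- All coordinate functionals of the frame. -/
def coord (F : JoinFrame V ρ α β) : (ρ × α) ⊕ (ρ × β) → StrongDual ℝ V :=
  Sum.elim (fun t => F.X t.1 t.2) fun t => F.Y t.1 t.2

/-- The face on which a coordinate vanishes. -/
def face (F : JoinFrame V ρ α β) (c : (ρ × α) ⊕ (ρ × β)) : Set V :=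
  {p ∈ F.polytope | F.coord c p = 0}

lemma exists_vertex_coord_eq_one (F : JoinFrame V ρ α β) [Nonempty α] [Nonempty β]
    (c : (ρ × α) ⊕ (ρ × β)) : ∃ t, F.coord c (F.vertex t) = 1 := by
  rcases c with ⟨r, i⟩ | ⟨r, j⟩
  · exact ⟨(r, i, Classical.arbitrary β), by simp [coord]⟩
  · exact ⟨(r, Classical.arbitrary α, j), by simp [coord]⟩

lemma vertex_mem_face_inr (F : JoinFrame V ρ α β) {r : ρ} {j : β} {t : ρ × α × β} :
    F.vertex t ∈ F.face (.inr (r, j)) ↔ ¬ (r = t.1 ∧ j = t.2.2) := by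
  simp [face, coord, F.vertex_mem]

lemma vertex_mem_face_inl (F : JoinFrame V ρ α β) {r : ρ} {i : α} {t : ρ × α × β} :
    F.vertex t ∈ F.face (.inl (r, i)) ↔ ¬ (r = t.1 ∧ i = t.2.1) := by
  simp [face, coord, F.vertex_mem]

lemma swap_face (F : JoinFrame V ρ α β) (c : (ρ × α) ⊕ (ρ × β)) :
    F.swap.face c.swap = F.face c := by
  unfold face
  rw [swap_polytope]
  rcases c with c | c <;> rfl

lemma face_inr_injective (F : JoinFrame V ρ α β) [Nonempty α] :
    Function.Injective fun t : ρ × β => F.face (.inr t) := by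
  rintro ⟨r, j⟩ ⟨r', j'⟩ h
  by_contra hne
  have h1 : F.vertex (r, Classical.arbitrary α, j) ∈ F.face (.inr (r', j')) :=
    F.vertex_mem_face_inr.2 fun hh => hne (by rw [hh.1, hh.2])
  have h' : F.face (.inr (r, j)) = F.face (.inr (r', j')) := h
  rw [← h', vertex_mem_face_inr] at h1
  exact h1 ⟨rfl, rfl⟩

lemma face_inl_injective (F : JoinFrame V ρ α β) [Nonempty β] :
    Function.Injective fun t : ρ × α => F.face (.inl t) := by
  intro t t' h
  refine F.swap.face_inr_injective (a₁ := t) (a₂ := t') ?_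
  have h1 := F.swap_face (.inl t)
  have h2 := F.swap_face (.inl t')
  exact h1.trans (h.trans h2.symm)

/-- A vertex `(r, i, j₁)` with `j₁ ≠ j` separates an `X`-face at `(r, i)` from a `Y`-face at `j`. -/
lemma face_injective (F : JoinFrame V ρ α β) [Nontrivial α] [Nontrivial β] :
    Function.Injective F.face := by
  have key : ∀ t t', F.face (.inl t) ≠ F.face (.inr t') := by
    rintro ⟨r, i⟩ ⟨r', j⟩ h
    obtain ⟨j₁, hj₁⟩ := exists_ne j
    have h1 : F.vertex (r, i, j₁) ∈ F.face (.inr (r', j)) :=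
      F.vertex_mem_face_inr.2 fun hh => hj₁ hh.2.symm
    rw [← h, vertex_mem_face_inl] at h1
    exact h1 ⟨rfl, rfl⟩
  rintro (t | t) (t' | t') h
  · exact congrArg _ (F.face_inl_injective h)
  · exact absurd h (key t t')
  · exact absurd h.symm (key t' t)
  · exact congrArg _ (F.face_inr_injective h)

variable [Fintype ρ] [Fintype α]

/-- The sum of all coordinates of the first kind. -/
def height (F : JoinFrame V ρ α β) : V →ₗ[ℝ] ℝ := ∑ r, ∑ i, (F.X r i).toLinearMap

lemma height_apply (F : JoinFrame V ρ α β) (p : V) : F.height p = ∑ r, ∑ i, F.X r i p := by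
  simp [height]

variable [Fintype β]

/-- The projection onto the span of the frame. -/
def expansion (F : JoinFrame V ρ α β) (p : V) : V :=
  ∑ r, (∑ i, F.X r i p • F.A r i + ∑ j, F.Y r j p • F.B r j)

/-- The submodule of expandable vectors with balanced coordinates. -/
def balanced (F : JoinFrame V ρ α β) : Submodule ℝ V where
  carrier := {p | F.expansion p = p ∧ ∀ r, ∑ i, F.X r i p = ∑ j, F.Y r j p}
  zero_mem' := by simp [expansion]
  add_mem' := by
    rintro p p' ⟨h1, h2⟩ ⟨h1', h2'⟩
    refine ⟨?_, fun r => ?_⟩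
    · conv_rhs => rw [← h1, ← h1']
      simp only [expansion, map_add, add_smul, Finset.sum_add_distrib]
      abel
    · simp [Finset.sum_add_distrib, h2, h2']
  smul_mem' := by
    rintro c p ⟨h1, h2⟩
    refine ⟨?_, fun r => ?_⟩
    · conv_rhs => rw [← h1]
      simp only [expansion, map_smul, smul_assoc, Finset.smul_sum, Finset.sum_add_distrib, smul_add]
    · simp [← Finset.mul_sum, h2]

lemma vertex_mem_balanced (F : JoinFrame V ρ α β) (t : ρ × α × β) : F.vertex t ∈ F.balanced := by
  refine ⟨?_, fun r => ?_⟩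
  · simp [expansion, ite_smul, Finset.sum_ite_irrel, Finset.sum_add_distrib, vertex, F.X_A, F.X_B,
      F.Y_A, F.Y_B]
  · by_cases h : r = t.1 <;> simp [h]

lemma eq_of_coords (F : JoinFrame V ρ α β) {p p' : V} (hp : p ∈ F.balanced)
    (hp' : p' ∈ F.balanced) (hX : ∀ r i, F.X r i p = F.X r i p')
    (hY : ∀ r j, F.Y r j p = F.Y r j p') : p = p' := by
  rw [← hp.1, ← hp'.1]
  simp [expansion, hX, hY]

lemma balanced_le_span_vertex (F : JoinFrame V ρ α β) [Nonempty α] [Nonempty β] :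
    F.balanced ≤ Submodule.span ℝ (Set.range F.vertex) := by
  intro p hp
  obtain ⟨i₀⟩ := ‹Nonempty α›
  obtain ⟨j₀⟩ := ‹Nonempty β›
  have hw : ∀ t, F.vertex t ∈ Submodule.span ℝ (Set.range F.vertex) :=
    fun t => Submodule.subset_span ⟨t, rfl⟩
  -- With `σ` the common sum of the `X`- and `Y`-coordinates in block `r`, the first two sums
  -- overshoot by `σ • (A r i₀ + B r j₀)`, which the last term removes.
  have key : p = ∑ r, (∑ i, F.X r i p • F.vertex (r, i, j₀) + ∑ j, F.Y r j p • F.vertex (r, i₀, j)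
      - (∑ i, F.X r i p) • F.vertex (r, i₀, j₀)) := by
    conv_lhs => rw [← hp.1]
    refine Finset.sum_congr rfl fun r _ => ?_
    simp only [vertex, smul_add, Finset.sum_add_distrib, ← Finset.sum_smul]
    rw [hp.2 r]
    abel
  rw [key]
  exact Submodule.sum_mem _ fun r _ => Submodule.sub_mem _ (Submodule.add_mem _
    (Submodule.sum_mem _ fun i _ => Submodule.smul_mem _ _ (hw _))
    (Submodule.sum_mem _ fun i _ => Submodule.smul_mem _ _ (hw _)))
    (Submodule.smul_mem _ _ (hw _))

lemma span_polytope_eq (F : JoinFrame V ρ α β) [Nonempty α] [Nonempty β] :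
    Submodule.span ℝ F.polytope = F.balanced := by
  refine le_antisymm (Submodule.span_le.2 (convexHull_min ?_ F.balanced.convex)) ?_
  · rintro _ ⟨t, rfl⟩
    exact F.vertex_mem_balanced t
  · exact F.balanced_le_span_vertex.trans (Submodule.span_mono (subset_convexHull _ _))

lemma polytope_subset_balanced (F : JoinFrame V ρ α β) : F.polytope ⊆ F.balanced := by
  refine convexHull_min ?_ F.balanced.convex
  rintro _ ⟨t, rfl⟩
  exact F.vertex_mem_balanced t

/-- For the converse, each block is a transportation problem: two nonnegative vectors of equal mass
are the marginals of their normalised product, whose entries serve as vertex weights. -/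
lemma mem_polytope_iff (F : JoinFrame V ρ α β) {p : V} :
    p ∈ F.polytope ↔ p ∈ F.balanced ∧ (∀ r i, 0 ≤ F.X r i p) ∧ (∀ r j, 0 ≤ F.Y r j p) ∧
      F.height p = 1 := by
  constructor
  · refine fun hp => ⟨F.polytope_subset_balanced hp, ?_⟩
    have hc : Convex ℝ {p : V | (∀ r i, 0 ≤ F.X r i p) ∧ (∀ r j, 0 ≤ F.Y r j p) ∧
        F.height p = 1} := by
      rintro x ⟨h1, h2, h3⟩ y ⟨h1', h2', h3'⟩ a b ha hb hab
      refine ⟨fun r i => ?_, fun r j => ?_, ?_⟩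
      · simpa using add_nonneg (mul_nonneg ha (h1 r i)) (mul_nonneg hb (h1' r i))
      · simpa using add_nonneg (mul_nonneg ha (h2 r j)) (mul_nonneg hb (h2' r j))
      · simp [h3, h3', hab]
    refine convexHull_min ?_ hc hp
    rintro _ ⟨t, rfl⟩
    refine ⟨fun r i => ?_, fun r i => ?_, ?_⟩
    · rw [X_vertex]; split_ifs <;> norm_num
    · rw [Y_vertex]; split_ifs <;> norm_num
    · simp [height_apply, Finset.sum_ite_irrel]
  · rintro ⟨hb, hX, hY, h1⟩
    set s : ρ → ℝ := fun r => ∑ i, F.X r i p with hs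
    -- A block of mass zero has all coordinates zero, so the identity survives the convention `0 / 0
    -- = 0`.
    have hXs : ∀ r i, F.X r i p * (s r / s r) = F.X r i p := by
      intro r i
      by_cases h : s r = 0
      · have := (Finset.sum_eq_zero_iff_of_nonneg fun i _ => hX r i).1 h i (Finset.mem_univ i)
        simp [this]
      · rw [div_self h, mul_one]
    have hYs : ∀ r j, F.Y r j p * (s r / s r) = F.Y r j p := by
      intro r j
      by_cases h : s r = 0
      · have h' : ∑ j, F.Y r j p = 0 := by rw [← hb.2 r]; exact h
        have := (Finset.sum_eq_zero_iff_of_nonneg fun j _ => hY r j).1 h' j (Finset.mem_univ j)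
        simp [this]
      · rw [div_self h, mul_one]
    set c : ρ × α × β → ℝ := fun t => F.X t.1 t.2.1 p * F.Y t.1 t.2.2 p / s t.1 with hcdef
    have hsY : ∀ r, ∑ j, F.Y r j p = s r := fun r => (hb.2 r).symm
    have hrow : ∀ r i, ∑ j, c (r, i, j) = F.X r i p := by
      intro r i
      simp only [hcdef]
      rw [← Finset.sum_div, ← Finset.mul_sum, hsY, mul_div_assoc, hXs]
    have hcol : ∀ r j, ∑ i, c (r, i, j) = F.Y r j p := by
      intro r j
      simp only [hcdef]
      rw [← Finset.sum_div, ← Finset.sum_mul, mul_comm, mul_div_assoc]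
      exact hYs r j
    have hsum : ∑ t, c t = 1 := by
      rw [← h1, height_apply]
      simp only [Fintype.sum_prod_type, hrow]
    have hcomb : ∑ t, c t • F.vertex t = p := by
      conv_rhs => rw [← hb.1]
      simp only [Fintype.sum_prod_type, expansion, vertex, smul_add, Finset.sum_add_distrib]
      congr 1
      · simp only [← Finset.sum_smul, hrow]
      · refine Finset.sum_congr rfl fun r _ => ?_
        rw [Finset.sum_comm]
        simp only [← Finset.sum_smul, hcol]
    rw [← hcomb]
    refine (convex_convexHull ℝ _).sum_mem (fun t _ => ?_) hsum fun t _ => F.vertex_mem t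
    exact div_nonneg (mul_nonneg (hX _ _) (hY _ _)) (Finset.sum_nonneg fun i _ => hX _ _)

lemma polytope_finiteDimensional (F : JoinFrame V ρ α β) [Nonempty α] [Nonempty β] :
    FiniteDimensional ℝ (Submodule.span ℝ F.polytope) := by
  rw [span_polytope_eq]
  have : FiniteDimensional ℝ (Submodule.span ℝ (Set.range F.vertex)) :=
    FiniteDimensional.span_of_finite ℝ (Set.finite_range _)
  exact Submodule.finiteDimensional_of_le F.balanced_le_span_vertex

/-- The span is the injective image under `Ψ` of the coordinate vectors satisfying the `ρ`-many
independent balance equations `T = 0`; rank-nullity gives the count. -/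
lemma finrank_span_polytope (F : JoinFrame V ρ α β) [Nonempty α] [Nonempty β] :
    finrank ℝ (Submodule.span ℝ F.polytope) + Fintype.card ρ =
      Fintype.card ρ * Fintype.card α + Fintype.card ρ * Fintype.card β := by
  let T : ((ρ × α → ℝ) × (ρ × β → ℝ)) →ₗ[ℝ] (ρ → ℝ) :=
    { toFun := fun z r => ∑ i, z.1 (r, i) - ∑ j, z.2 (r, j)
      map_add' := fun z z' => by
        funext r; simp [Finset.sum_add_distrib]; ring
      map_smul' := fun c z => by
        funext r; simp [← Finset.mul_sum, mul_sub] }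
  let Ψ : ((ρ × α → ℝ) × (ρ × β → ℝ)) →ₗ[ℝ] V :=
    { toFun := fun z => ∑ r, (∑ i, z.1 (r, i) • F.A r i + ∑ j, z.2 (r, j) • F.B r j)
      map_add' := fun z z' => by
        simp only [Prod.fst_add, Prod.snd_add, Pi.add_apply, add_smul, Finset.sum_add_distrib]
        abel
      map_smul' := fun c z => by
        simp [smul_add, Finset.smul_sum, mul_smul] }
  have hX : ∀ z r i, F.X r i (Ψ z) = z.1 (r, i) := by
    intro z r i
    simp [Ψ, F.X_A, F.X_B, Finset.sum_ite_irrel]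
  have hY : ∀ z r j, F.Y r j (Ψ z) = z.2 (r, j) := by
    intro z r j
    simp [Ψ, F.Y_A, F.Y_B, Finset.sum_ite_irrel]
  have hΨ : Function.Injective Ψ := by
    intro z z' h
    ext t
    · rw [← hX z, ← hX z', h]
    · rw [← hY z, ← hY z', h]
  have hT : Function.Surjective T := by
    intro u
    obtain ⟨i₀⟩ := ‹Nonempty α›
    refine ⟨(fun t => if t.2 = i₀ then u t.1 else 0, 0), ?_⟩
    funext r
    simp [T]
  have hmap : Submodule.span ℝ F.polytope = (LinearMap.ker T).map Ψ := by
    rw [span_polytope_eq]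
    ext p
    constructor
    · intro hp
      refine ⟨(fun t => F.X t.1 t.2 p, fun t => F.Y t.1 t.2 p), ?_, hp.1⟩
      refine LinearMap.mem_ker.2 (funext fun r => ?_)
      simp [T, hp.2 r]
    · rintro ⟨z, hz, rfl⟩
      refine ⟨?_, fun r => ?_⟩
      · simp only [expansion, hX, hY]
        rfl
      · simp only [hX, hY]
        exact sub_eq_zero.1 (congrFun (LinearMap.mem_ker.1 hz) r)
  rw [hmap, ← (Submodule.equivMapOfInjective Ψ hΨ _).finrank_eq]
  have := T.finrank_range_add_finrank_ker
  rw [LinearMap.range_eq_top.2 hT, finrank_top] at this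
  simp at this
  omega

end JoinFrame

/-! ### Dimension, vertices and facets -/

lemma polytopeDim_eq_finrank_span {V : Type*} [AddCommGroup V] [Module ℝ V] {P : Set V}
    [FiniteDimensional ℝ (Submodule.span ℝ P)] (f : V →ₗ[ℝ] ℝ) (hf : ∀ x ∈ P, f x = 1) :
    polytopeDim P = (finrank ℝ (Submodule.span ℝ P) : ℤ) - 1 := by
  unfold polytopeDim
  -- The empty set fits the formula: its dimension `-1` is `0 - 1`.
  split_ifs with h
  · rw [h, Submodule.span_empty, finrank_bot]
    norm_num
  · obtain ⟨p, hp⟩ := Set.nonempty_iff_ne_empty.2 h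
    have hle : vectorSpan ℝ P ≤ Submodule.span ℝ P := by
      refine Submodule.span_le.2 ?_
      rintro _ ⟨x, hx, y, hy, rfl⟩
      exact Submodule.sub_mem _ (Submodule.subset_span hx) (Submodule.subset_span hy)
    have hker : vectorSpan ℝ P ≤ LinearMap.ker f := by
      refine Submodule.span_le.2 ?_
      rintro _ ⟨x, hx, y, hy, rfl⟩
      simp [hf x hx, hf y hy]
    have hp0 : p ≠ 0 := by
      rintro rfl
      simpa using hf 0 hp
    -- The linear span is the direction space plus the line through `p`; the sum is direct because
    -- `f` vanishes on the first and is 1 at `p`.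
    have hsup : vectorSpan ℝ P ⊔ Submodule.span ℝ {p} = Submodule.span ℝ P := by
      refine le_antisymm (sup_le hle (Submodule.span_mono (by simpa using hp))) ?_
      refine Submodule.span_le.2 fun x hx => ?_
      rw [← sub_add_cancel x p]
      exact Submodule.add_mem_sup (vsub_mem_vectorSpan ℝ hx hp) (Submodule.mem_span_singleton_self p)
    have hinf : vectorSpan ℝ P ⊓ Submodule.span ℝ {p} = ⊥ := by
      rw [eq_bot_iff]
      rintro x ⟨hx1, hx2⟩
      obtain ⟨c, rfl⟩ := Submodule.mem_span_singleton.1 hx2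
      have := hker hx1
      simp only [LinearMap.mem_ker, map_smul, hf p hp, smul_eq_mul, mul_one] at this
      simp [this]
    have : FiniteDimensional ℝ (vectorSpan ℝ P) := Submodule.finiteDimensional_of_le hle
    have key := Submodule.finrank_sup_add_finrank_inf_eq (vectorSpan ℝ P) (Submodule.span ℝ {p})
    rw [hsup, hinf, finrank_span_singleton hp0] at key
    simp at key
    omega

namespace JoinFrame

variable {V ρ α β : Type*} [AddCommGroup V] [Module ℝ V] [TopologicalSpace V]
  [DecidableEq ρ] [DecidableEq α] [DecidableEq β] [Fintype ρ] [Fintype α] [Fintype β]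

lemma height_eq_one (F : JoinFrame V ρ α β) {p : V} (hp : p ∈ F.polytope) : F.height p = 1 :=
  (F.mem_polytope_iff.1 hp).2.2.2

lemma polytopeDim_subset (F : JoinFrame V ρ α β) [Nonempty α] [Nonempty β] {G : Set V}
    (hG : G ⊆ F.polytope) : polytopeDim G = (finrank ℝ (Submodule.span ℝ G) : ℤ) - 1 := by
  have := F.polytope_finiteDimensional
  have : FiniteDimensional ℝ (Submodule.span ℝ G) :=
    Submodule.finiteDimensional_of_le (Submodule.span_mono hG)
  exact polytopeDim_eq_finrank_span F.height fun x hx => F.height_eq_one (hG hx)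

lemma isFacet_iff (F : JoinFrame V ρ α β) [Nonempty α] [Nonempty β] {G : Set V} :
    IsFacet F.polytope G ↔ IsExposed ℝ F.polytope G ∧
      finrank ℝ (Submodule.span ℝ G) + 1 = finrank ℝ (Submodule.span ℝ F.polytope) := by
  refine and_congr_right fun h => ?_
  rw [F.polytopeDim_subset h.subset, F.polytopeDim_subset subset_rfl]
  omega

lemma X_le_one (F : JoinFrame V ρ α β) {p : V} (hp : p ∈ F.polytope) (r : ρ) (i : α) :
    F.X r i p ≤ 1 := by
  obtain ⟨-, hX, -, h1⟩ := F.mem_polytope_iff.1 hp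
  rw [← h1, height_apply]
  exact (Finset.single_le_sum (f := fun i => F.X r i p) (fun i _ => hX r i)
    (Finset.mem_univ i)).trans (Finset.single_le_sum (f := fun r => ∑ i, F.X r i p)
    (fun r _ => Finset.sum_nonneg fun i _ => hX r i) (Finset.mem_univ r))

lemma Y_le_one (F : JoinFrame V ρ α β) {p : V} (hp : p ∈ F.polytope) (r : ρ) (j : β) :
    F.Y r j p ≤ 1 :=
  F.swap.X_le_one (F.swap_mem.2 hp) r j

lemma X_eq_zero_of_X_eq_one (F : JoinFrame V ρ α β) {p : V} (hp : p ∈ F.polytope) {r : ρ} {i : α}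
    (h : F.X r i p = 1) {r' : ρ} {i' : α} (hne : ¬ (r' = r ∧ i' = i)) : F.X r' i' p = 0 := by
  obtain ⟨-, hX, -, h1⟩ := F.mem_polytope_iff.1 hp
  rw [height_apply, ← Fintype.sum_prod_type' fun r i => F.X r i p] at h1
  have hle := Finset.add_le_sum (s := Finset.univ) (f := fun t : ρ × α => F.X t.1 t.2 p)
    (fun t _ => hX t.1 t.2) (Finset.mem_univ (r', i')) (Finset.mem_univ (r, i))
    (fun h => hne (Prod.ext_iff.1 h))
  simp only at hle
  linarith [hX r' i']

/-- Coordinates are at most 1 on the polytope, so two points with `vertex t` strictly between them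
both have the two coordinates of `t` equal to 1. All their other coordinates then vanish. -/
lemma extremePoints_polytope (F : JoinFrame V ρ α β) :
    Set.extremePoints ℝ F.polytope = Set.range F.vertex := by
  refine Set.Subset.antisymm extremePoints_convexHull_subset ?_
  rintro _ ⟨t, rfl⟩
  refine ⟨F.vertex_mem t, ?_⟩
  intro x hx y hy hxy
  obtain ⟨a, b, ha, hb, hab, h⟩ := hxy
  have hXx : F.X t.1 t.2.1 x = 1 := by
    have h' := congrArg (F.X t.1 t.2.1) h
    simp at h'
    nlinarith [F.X_le_one hx t.1 t.2.1, F.X_le_one hy t.1 t.2.1]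
  have hYx : F.Y t.1 t.2.2 x = 1 := by
    have h' := congrArg (F.Y t.1 t.2.2) h
    simp at h'
    nlinarith [F.Y_le_one hx t.1 t.2.2, F.Y_le_one hy t.1 t.2.2]
  refine F.eq_of_coords (F.polytope_subset_balanced hx) (F.vertex_mem_balanced t) ?_ ?_
  · intro r i
    rw [X_vertex, ← ite_and]
    split_ifs with hri
    · rw [hri.1, hri.2, hXx]
    · exact F.X_eq_zero_of_X_eq_one hx hXx hri
  · intro r j
    rw [Y_vertex, ← ite_and]
    split_ifs with hri
    · rw [hri.1, hri.2, hYx]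
    · exact F.swap.X_eq_zero_of_X_eq_one (F.swap_mem.2 hx) hYx hri

lemma ncard_extremePoints (F : JoinFrame V ρ α β) :
    (Set.extremePoints ℝ F.polytope).ncard =
      Fintype.card ρ * (Fintype.card α * Fintype.card β) := by
  rw [extremePoints_polytope, ← Set.image_univ, Set.ncard_image_of_injective _ F.vertex_injective,
    Set.ncard_univ, Nat.card_eq_fintype_card, Fintype.card_prod, Fintype.card_prod]

lemma coord_nonneg (F : JoinFrame V ρ α β) {p : V} (hp : p ∈ F.polytope)
    (c : (ρ × α) ⊕ (ρ × β)) : 0 ≤ F.coord c p := by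
  obtain ⟨-, hX, hY, -⟩ := F.mem_polytope_iff.1 hp
  rcases c with c | c
  · exact hX _ _
  · exact hY _ _

lemma coord_le_one (F : JoinFrame V ρ α β) {p : V} (hp : p ∈ F.polytope)
    (c : (ρ × α) ⊕ (ρ × β)) : F.coord c p ≤ 1 := by
  rcases c with c | c
  · exact F.X_le_one hp _ _
  · exact F.Y_le_one hp _ _

lemma mem_polytope_of_coord (F : JoinFrame V ρ α β) {p : V} (hp : p ∈ F.balanced)
    (hc : ∀ c, 0 ≤ F.coord c p) (h1 : F.height p = 1) : p ∈ F.polytope :=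
  F.mem_polytope_iff.2 ⟨hp, fun r i => hc (.inl (r, i)), fun r j => hc (.inr (r, j)), h1⟩

lemma isExposed_face (F : JoinFrame V ρ α β) (c : (ρ × α) ⊕ (ρ × β)) :
    IsExposed ℝ F.polytope (F.face c) := by
  rintro ⟨y, hy, hy0⟩
  refine ⟨-F.coord c, Set.ext fun x => ⟨?_, ?_⟩⟩
  · rintro ⟨hx, hx0⟩
    refine ⟨hx, fun z hz => ?_⟩
    simpa [hx0] using F.coord_nonneg hz c
  · rintro ⟨hx, hmax⟩
    have := hmax y hy
    simp [hy0] at this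
    exact ⟨hx, le_antisymm this (F.coord_nonneg hx c)⟩

/-- Such a `p` is a relative interior point: one can move from `p` slightly away from any `w`, so a
functional maximal at `p` is also maximal at `w`. -/
lemma eq_polytope_of_coord_pos (F : JoinFrame V ρ α β) [Nonempty α] [Nonempty β] {G : Set V}
    (hG : IsExposed ℝ F.polytope G) {p : V} (hp : p ∈ G) (hpos : ∀ c, 0 < F.coord c p) :
    G = F.polytope := by
  obtain ⟨l, hl⟩ := hG ⟨p, hp⟩
  have hpP := hG.subset hp
  refine hG.subset.antisymm ?_
  have hex : ∃ ε > 0, ∀ c, ε ≤ F.coord c p := by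
    rcases isEmpty_or_nonempty ((ρ × α) ⊕ (ρ × β)) with h | h
    · exact ⟨1, one_pos, fun c => h.elim c⟩
    · obtain ⟨c, hc⟩ := Finite.exists_min fun c => F.coord c p
      exact ⟨_, hpos c, hc⟩
  obtain ⟨ε, hε, hle⟩ := hex
  intro w hw
  have hmem : p + ε • (p - w) ∈ F.polytope := by
    have hb := F.polytope_subset_balanced hpP
    refine F.mem_polytope_of_coord (F.balanced.add_mem hb (F.balanced.smul_mem _
      (F.balanced.sub_mem hb (F.polytope_subset_balanced hw)))) (fun c => ?_) ?_
    · simp only [map_add, map_smul, map_sub, smul_eq_mul]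
      -- Each coordinate is at least `ε + ε * (coord c p - 1)`, which is positive.
      nlinarith [hle c, F.coord_le_one hw c, hpos c]
    · simp [F.height_eq_one hpP, F.height_eq_one hw]
  rw [hl] at hp ⊢
  have := hp.2 _ hmem
  simp only [map_add, map_smul, map_sub, smul_eq_mul] at this
  refine ⟨hw, fun y hy => (hp.2 y hy).trans ?_⟩
  nlinarith

/-- Otherwise each coordinate is positive somewhere on `G`; averaging such points gives one with all
coordinates positive, and `G` would be the whole polytope. -/
lemma exists_subset_face (F : JoinFrame V ρ α β) [Nonempty ρ] [Nonempty α] [Nonempty β] {G : Set V}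
    (hG : IsFacet F.polytope G) : ∃ c, G ⊆ F.face c := by
  have hex := hG.1
  rw [isFacet_iff] at hG
  by_contra! hcon
  have hsel : ∀ c, ∃ p ∈ G, 0 < F.coord c p := by
    intro c
    obtain ⟨p, hp, hpc⟩ := Set.not_subset.1 (hcon c)
    have hpP := hex.subset hp
    exact ⟨p, hp, lt_of_le_of_ne (F.coord_nonneg hpP c) fun h => hpc ⟨hpP, h.symm⟩⟩
  choose v hv hpos using hsel
  have hmem : ∑ c, ((Fintype.card ((ρ × α) ⊕ (ρ × β)) : ℝ)⁻¹) • v c ∈ G := by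
    refine (hex.convex (convex_convexHull ℝ _)).sum_mem (fun c _ => by positivity) ?_
      fun c _ => hv c
    have : (Fintype.card ((ρ × α) ⊕ (ρ × β)) : ℝ) ≠ 0 := Nat.cast_ne_zero.2 Fintype.card_ne_zero
    rw [Finset.sum_const, Finset.card_univ, nsmul_eq_mul, mul_inv_cancel₀ this]
  have heq := F.eq_polytope_of_coord_pos hex hmem fun c => by
    simp only [map_sum, map_smul, smul_eq_mul]
    refine Finset.sum_pos' (fun c' _ => mul_nonneg (by positivity)
      (F.coord_nonneg (hex.subset (hv c')) c)) ⟨c, Finset.mem_univ c, mul_pos ?_ (hpos c)⟩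
    have : 0 < Fintype.card ((ρ × α) ⊕ (ρ × β)) := Fintype.card_pos
    positivity
  rw [heq] at hG
  omega

lemma finrank_span_face_lt (F : JoinFrame V ρ α β) [Nonempty α] [Nonempty β]
    (c : (ρ × α) ⊕ (ρ × β)) :
    finrank ℝ (Submodule.span ℝ (F.face c)) < finrank ℝ (Submodule.span ℝ F.polytope) := by
  have := F.polytope_finiteDimensional
  refine Submodule.finrank_lt_finrank_of_lt (lt_of_le_of_ne
    (Submodule.span_mono fun x hx => hx.1) fun h => ?_)
  obtain ⟨t, ht⟩ := F.exists_vertex_coord_eq_one c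
  have hle : Submodule.span ℝ (F.face c) ≤ LinearMap.ker (F.coord c).toLinearMap :=
    Submodule.span_le.2 fun x hx => hx.2
  have h0 : F.coord c (F.vertex t) = 0 := hle (h ▸ Submodule.subset_span (F.vertex_mem t))
  rw [ht] at h0
  exact one_ne_zero h0

/-- Comparing dimensions, `G` and the face have the same span. If `l` exposes `G` with maximum `l
p`, then `l - l p • height` vanishes on that span, so `l` is maximal on the whole face. -/
lemma eq_face_of_subset (F : JoinFrame V ρ α β) [Nonempty α] [Nonempty β] {G : Set V}
    (hG : IsFacet F.polytope G) {c : (ρ × α) ⊕ (ρ × β)} (hc : G ⊆ F.face c) : G = F.face c := by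
  rw [isFacet_iff] at hG
  have := F.polytope_finiteDimensional
  have : FiniteDimensional ℝ (Submodule.span ℝ (F.face c)) :=
    Submodule.finiteDimensional_of_le (Submodule.span_mono fun x hx => hx.1)
  have hspan : Submodule.span ℝ G = Submodule.span ℝ (F.face c) :=
    Submodule.eq_of_le_of_finrank_le (Submodule.span_mono hc) (by
      have := F.finrank_span_face_lt c
      omega)
  refine hc.antisymm fun x hx => ?_
  have hxs : x ∈ Submodule.span ℝ G := hspan ▸ Submodule.subset_span hx
  rcases G.eq_empty_or_nonempty with rfl | hne
  · rw [Submodule.span_empty, Submodule.mem_bot] at hxs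
    have := F.height_eq_one hx.1
    rw [hxs, map_zero] at this
    exact absurd this zero_ne_one
  · obtain ⟨l, hl⟩ := hG.1 hne
    obtain ⟨p, hp⟩ := hne
    have hle : Submodule.span ℝ G ≤ LinearMap.ker (l.toLinearMap - l p • F.height) := by
      refine Submodule.span_le.2 fun y hy => ?_
      have h1 := F.height_eq_one (hG.1.subset hy)
      rw [hl] at hp hy
      have h2 : l y = l p := le_antisymm (hp.2 y hy.1) (hy.2 p hp.1)
      simp [h1, h2]
    have hlx : l x = l p := by
      have := hle hxs
      simp [F.height_eq_one hx.1] at this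
      linarith
    rw [hl] at hp ⊢
    exact ⟨hx.1, fun y hy => hlx ▸ hp.2 y hy⟩

/-- Adjoining one missing vertex `w` must restore the full span. Differences `vertex (r, i, j) - w`
do not depend on `j`, so a second `j₁` realises them inside the face. With only one `j` the whole
block is lost, which has codimension one only when `α` is a point. -/
lemma isFacet_face_inr (F : JoinFrame V ρ α β) [Nonempty α] [Nonempty β]
    (h : Subsingleton α ∨ Nontrivial β) (r : ρ) (j : β) :
    IsFacet F.polytope (F.face (.inr (r, j))) := by
  rw [isFacet_iff]
  refine ⟨F.isExposed_face _, le_antisymm (F.finrank_span_face_lt _) ?_⟩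
  set S := Submodule.span ℝ (F.face (.inr (r, j))) with hS
  obtain ⟨i₀⟩ := ‹Nonempty α›
  have : Nonempty α := ⟨i₀⟩
  have := F.polytope_finiteDimensional
  have : FiniteDimensional ℝ S :=
    Submodule.finiteDimensional_of_le (Submodule.span_mono fun x hx => hx.1)
  have hmem : ∀ t : ρ × α × β, ¬ (r = t.1 ∧ j = t.2.2) → F.vertex t ∈ S :=
    fun t ht => Submodule.subset_span (F.vertex_mem_face_inr.2 ht)
  set w := F.vertex (r, i₀, j)
  have hdiff : ∀ i, F.vertex (r, i, j) - w ∈ S := by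
    intro i
    rcases h with h | h
    · rw [Subsingleton.elim i i₀, sub_self]
      exact S.zero_mem
    · obtain ⟨j₁, hj₁⟩ := exists_ne j
      have : F.vertex (r, i, j) - w = F.vertex (r, i, j₁) - F.vertex (r, i₀, j₁) := by
        simp [w, vertex]
      rw [this]
      exact S.sub_mem (hmem _ fun h => hj₁ h.2.symm) (hmem _ fun h => hj₁ h.2.symm)
  have hle : Submodule.span ℝ F.polytope ≤ S ⊔ Submodule.span ℝ {w} := by
    rw [span_polytope_eq]
    refine F.balanced_le_span_vertex.trans (Submodule.span_le.2 ?_)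
    rintro _ ⟨⟨r', i, j'⟩, rfl⟩
    by_cases hc : r = r' ∧ j = j'
    · obtain ⟨rfl, rfl⟩ := hc
      rw [← sub_add_cancel (F.vertex (r, i, j)) w]
      exact Submodule.add_mem_sup (hdiff i) (Submodule.mem_span_singleton_self w)
    · exact Submodule.mem_sup_left (hmem _ hc)
  refine (Submodule.finrank_mono hle).trans
    ((Submodule.finrank_add_le_finrank_add_finrank _ _).trans ?_)
  have hw : w ≠ 0 := fun h0 => by
    have := F.height_eq_one (F.vertex_mem (r, i₀, j))
    rw [show F.vertex (r, i₀, j) = 0 from h0, map_zero] at this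
    exact zero_ne_one this
  rw [finrank_span_singleton hw]

lemma isFacet_face_inl (F : JoinFrame V ρ α β) [Nonempty α] [Nonempty β]
    (h : Subsingleton β ∨ Nontrivial α) (r : ρ) (i : α) :
    IsFacet F.polytope (F.face (.inl (r, i))) := by
  rw [← swap_polytope, ← swap_face]
  exact F.swap.isFacet_face_inr h r i

lemma ncard_facets_of_nontrivial (F : JoinFrame V ρ α β) [Nonempty ρ] [Nontrivial α]
    [Nontrivial β] : {G | IsFacet F.polytope G}.ncard =
      Fintype.card ρ * Fintype.card α + Fintype.card ρ * Fintype.card β := by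
  have : {G | IsFacet F.polytope G} = F.face '' Set.univ := by
    ext G
    constructor
    · intro hG
      obtain ⟨c, hc⟩ := F.exists_subset_face hG
      exact ⟨c, trivial, (F.eq_face_of_subset hG hc).symm⟩
    · rintro ⟨c, -, rfl⟩
      rcases c with ⟨r, i⟩ | ⟨r, j⟩
      · exact F.isFacet_face_inl (.inr inferInstance) r i
      · exact F.isFacet_face_inr (.inr inferInstance) r j
  rw [this, Set.ncard_image_of_injective _ F.face_injective, Set.ncard_univ,
    Nat.card_eq_fintype_card, Fintype.card_sum, Fintype.card_prod, Fintype.card_prod]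

lemma ncard_facets_of_subsingleton (F : JoinFrame V ρ α β) [Nonempty ρ] [Nonempty α]
    [Subsingleton α] [Nonempty β] : {G | IsFacet F.polytope G}.ncard =
      Fintype.card ρ * Fintype.card β := by
  have : {G | IsFacet F.polytope G} = (fun t : ρ × β => F.face (.inr t)) '' Set.univ := by
    ext G
    constructor
    · intro hG
      obtain ⟨c, hc⟩ := F.exists_subset_face hG
      have hex : ∃ t, G ⊆ F.face (.inr t) := by
        rcases c with ⟨r, i⟩ | t
        -- Over a one-point `α` the balance equation reads `X r i = ∑ j, Y r j`, so vanishing of `X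
        -- r i` forces every `Y r j` to vanish.
        · refine ⟨(r, Classical.arbitrary β), fun x hx => ⟨(hc hx).1, ?_⟩⟩
          obtain ⟨hb, -, hY, -⟩ := F.mem_polytope_iff.1 (hc hx).1
          have h0 : ∑ i', F.X r i' x = 0 := Finset.sum_eq_zero fun i' _ => by
            rw [Subsingleton.elim i' i]
            exact (hc hx).2
          rw [hb.2 r] at h0
          exact (Finset.sum_eq_zero_iff_of_nonneg fun j _ => hY r j).1 h0 _ (Finset.mem_univ _)
        · exact ⟨t, hc⟩
      obtain ⟨t, ht⟩ := hex
      exact ⟨t, trivial, (F.eq_face_of_subset hG ht).symm⟩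
    · rintro ⟨⟨r, j⟩, -, rfl⟩
      exact F.isFacet_face_inr (.inl inferInstance) r j
  rw [this, Set.ncard_image_of_injective _ F.face_inr_injective, Set.ncard_univ,
    Nat.card_eq_fintype_card, Fintype.card_prod]

end JoinFrame

/-! ### Join decomposition and lattices -/

lemma span_convexHull_eq {V : Type*} [AddCommGroup V] [Module ℝ V] (s : Set V) :
    Submodule.span ℝ (convexHull ℝ s) = Submodule.span ℝ s :=
  le_antisymm (Submodule.span_le.2 (convexHull_min Submodule.subset_span
    (Submodule.span ℝ s).convex)) (Submodule.span_mono (subset_convexHull ℝ s))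

lemma iSupIndep_of_projections {R V ι : Type*} [Ring R] [AddCommGroup V] [Module R V]
    (S : ι → Submodule R V) (π : ι → V →ₗ[R] V) (h1 : ∀ i, ∀ x ∈ S i, π i x = x)
    (h0 : ∀ i j, j ≠ i → ∀ x ∈ S j, π i x = 0) : iSupIndep S := by
  intro i
  rw [Submodule.disjoint_def]
  intro x hx hx'
  have hle : (⨆ (j) (_ : j ≠ i), S j) ≤ LinearMap.ker (π i) :=
    iSup₂_le fun j hj y hy => h0 i j hj y hy
  rw [← h1 i x hx]
  exact hle hx'

lemma sum_smul_mem_lattice {V α β : Type*} [AddCommGroup V] [Module ℝ V]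
    [Fintype α] [Fintype β] {L : AddSubgroup V} {a : α → V} {b : β → V} {x : α → ℝ}
    {y : β → ℝ} (ha : ∀ i, a i ∈ L) (hb : ∀ j, b j ∈ L) (hx : ∀ i, ∃ z : ℤ, x i = z)
    (hy : ∀ j, ∃ z : ℤ, y j = z) : ∑ i, x i • a i + ∑ j, y j • b j ∈ L := by
  refine L.add_mem (L.sum_mem fun i _ => ?_) (L.sum_mem fun j _ => ?_)
  · obtain ⟨z, hz⟩ := hx i
    rw [hz, Int.cast_smul_eq_zsmul]
    exact L.zsmul_mem (ha i) z
  · obtain ⟨z, hz⟩ := hy j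
    rw [hz, Int.cast_smul_eq_zsmul]
    exact L.zsmul_mem (hb j) z

namespace JoinFrame

variable {V ρ α β : Type*} [AddCommGroup V] [Module ℝ V] [TopologicalSpace V]
  [DecidableEq ρ] [DecidableEq α] [DecidableEq β]

lemma polytope_eq_convexHull_components (F : JoinFrame V ρ α β) :
    F.polytope = convexHull ℝ (⋃ r, F.component r) := by
  refine Set.Subset.antisymm (convexHull_mono ?_) (convexHull_min ?_ (convex_convexHull ℝ _))
  · rintro _ ⟨⟨r, t⟩, rfl⟩
    exact Set.mem_iUnion.2 ⟨r, subset_convexHull _ _ ⟨t, rfl⟩⟩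
  · refine Set.iUnion_subset fun r => convexHull_mono ?_
    rintro _ ⟨t, rfl⟩
    exact ⟨(r, t), rfl⟩

lemma span_polytope_eq_iSup (F : JoinFrame V ρ α β) :
    Submodule.span ℝ F.polytope = ⨆ r, Submodule.span ℝ (F.component r) := by
  rw [polytope_eq_convexHull_components, span_convexHull_eq, Submodule.span_iUnion]

variable [Fintype α] [Fintype β]

/-- The projection onto the span of a single component. -/
def blockProj (F : JoinFrame V ρ α β) (r : ρ) : V →ₗ[ℝ] V :=
  ∑ i, (F.X r i).toLinearMap.smulRight (F.A r i) + ∑ j, (F.Y r j).toLinearMap.smulRight (F.B r j)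

lemma blockProj_apply (F : JoinFrame V ρ α β) (r : ρ) (p : V) :
    F.blockProj r p = ∑ i, F.X r i p • F.A r i + ∑ j, F.Y r j p • F.B r j := by
  simp [blockProj]

lemma blockProj_vertex (F : JoinFrame V ρ α β) (r : ρ) (t : ρ × α × β) :
    F.blockProj r (F.vertex t) = if r = t.1 then F.vertex t else 0 := by
  rw [blockProj_apply]
  by_cases h : r = t.1
  · simp [h, vertex, F.X_A, F.X_B, F.Y_A, F.Y_B]
  · simp [h]

lemma blockProj_of_mem_span_component (F : JoinFrame V ρ α β) (r : ρ) {p : V}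
    (hp : p ∈ Submodule.span ℝ (F.component r)) : F.blockProj r p = p := by
  have hle : Submodule.span ℝ (F.component r) ≤ LinearMap.ker (F.blockProj r - LinearMap.id) := by
    rw [component, span_convexHull_eq, Submodule.span_le]
    rintro _ ⟨t, rfl⟩
    simp [blockProj_vertex]
  exact sub_eq_zero.1 (hle hp)

lemma iSupIndep_span_component (F : JoinFrame V ρ α β) :
    iSupIndep fun r => Submodule.span ℝ (F.component r) := by
  refine iSupIndep_of_projections _ F.blockProj
    (fun r x hx => F.blockProj_of_mem_span_component r hx) fun r r' hne x hx => ?_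
  have hle : Submodule.span ℝ (F.component r') ≤ LinearMap.ker (F.blockProj r) := by
    rw [component, span_convexHull_eq, Submodule.span_le]
    rintro _ ⟨t, rfl⟩
    simp [blockProj_vertex, hne.symm]
  exact hle hx

lemma blockProj_mem_span_component (F : JoinFrame V ρ α β) (r : ρ) {p : V}
    (hp : p ∈ Submodule.span ℝ F.polytope) :
    F.blockProj r p ∈ Submodule.span ℝ (F.component r) := by
  have hle : Submodule.span ℝ F.polytope ≤
      (Submodule.span ℝ (F.component r)).comap (F.blockProj r) := by
    rw [polytope, span_convexHull_eq, Submodule.span_le]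
    rintro _ ⟨⟨r', t⟩, rfl⟩
    simp only [Submodule.comap_coe, Set.mem_preimage, blockProj_vertex]
    split_ifs with h
    · obtain rfl : r = r' := h
      exact Submodule.subset_span (subset_convexHull _ _ ⟨t, rfl⟩)
    · exact Submodule.zero_mem _
  exact hle hp

/-- The frame is integral with respect to the lattice `L`: the vectors lie in `L`, and the
coordinate functionals take integral values on `L`. -/
structure IsIntegral (F : JoinFrame V ρ α β) (L : AddSubgroup V) : Prop where
  A_mem : ∀ r i, F.A r i ∈ L
  B_mem : ∀ r j, F.B r j ∈ L
  X_int : ∀ r i, ∀ p ∈ L, ∃ z : ℤ, F.X r i p = z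
  Y_int : ∀ r j, ∀ p ∈ L, ∃ z : ℤ, F.Y r j p = z

lemma blockProj_mem_lattice {F : JoinFrame V ρ α β} {L : AddSubgroup V} (hL : F.IsIntegral L)
    (r : ρ) {p : V} (hp : p ∈ L) : F.blockProj r p ∈ L := by
  rw [blockProj_apply]
  exact sum_smul_mem_lattice (hL.A_mem r) (hL.B_mem r) (fun i => hL.X_int r i p hp)
    fun j => hL.Y_int r j p hp

/-- A lattice point of the span is the sum of its block projections, and these are again lattice
points because the coordinates are integers. -/
lemma lattice_eq_iSup [Fintype ρ] [Nonempty α] [Nonempty β] {F : JoinFrame V ρ α β}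
    {L : AddSubgroup V} (hL : F.IsIntegral L) :
    (Submodule.span ℝ F.polytope).toAddSubgroup ⊓ L =
      ⨆ r, (Submodule.span ℝ (F.component r)).toAddSubgroup ⊓ L := by
  refine le_antisymm ?_ (iSup_le fun r => inf_le_inf_right L ?_)
  · rintro p ⟨hp, hpL⟩
    have hb : p ∈ F.balanced := by
      rw [← span_polytope_eq]
      exact hp
    have hsum : ∑ r, F.blockProj r p = p := by
      conv_rhs => rw [← hb.1]
      simp only [expansion, blockProj_apply]
    rw [← hsum]
    refine AddSubgroup.sum_mem _ fun r _ => ?_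
    exact (le_iSup (fun r => (Submodule.span ℝ (F.component r)).toAddSubgroup ⊓ L) r)
      ⟨F.blockProj_mem_span_component r hp, blockProj_mem_lattice hL r hpL⟩
  · intro x hx
    change x ∈ Submodule.span ℝ F.polytope
    rw [span_polytope_eq_iSup]
    exact le_iSup (fun r => Submodule.span ℝ (F.component r)) r hx

/-- The coordinates belonging to a single component. -/
def blockCoords (F : JoinFrame V ρ α β) (r : ρ) : V →ₗ[ℝ] (α → ℝ) × (β → ℝ) :=
  (LinearMap.pi fun i => (F.X r i).toLinearMap).prod (LinearMap.pi fun j => (F.Y r j).toLinearMap)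

lemma blockCoords_image_component (F : JoinFrame V ρ α β) (r : ρ) :
    F.blockCoords r '' F.component r = stdSimplex ℝ α ×ˢ stdSimplex ℝ β := by
  rw [component, LinearMap.image_convexHull, ← convexHull_basis_eq_stdSimplex,
    ← convexHull_basis_eq_stdSimplex, ← convexHull_prod, Set.prod_range_range_eq, ← Set.range_comp]
  congr 2
  funext t
  ext i <;> simp [blockCoords, eq_comm]

/-- On the affine hull, `blockCoords` is inverted by expansion in the `A r i` and `B r j`; both
directions preserve integrality. -/
lemma latticeEquivalent_component {F : JoinFrame V ρ α β} {L : AddSubgroup V}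
    (hL : F.IsIntegral L) (r : ρ) :
    LatticeEquivalent L (F.component r) ((integerLattice α).prod (integerLattice β))
      (stdSimplex ℝ α ×ˢ stdSimplex ℝ β) := by
  have hrec : ∀ p ∈ affineSpan ℝ (F.component r), p = ∑ i, (F.blockCoords r p).1 i • F.A r i +
      ∑ j, (F.blockCoords r p).2 j • F.B r j := by
    intro p hp
    have := F.blockProj_of_mem_span_component r (affineSpan_subset_span hp)
    rw [blockProj_apply] at this
    exact this.symm
  refine ⟨(F.blockCoords r).toAffineMap, ?_, F.blockCoords_image_component r, ?_⟩
  · intro p hp p' hp' h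
    rw [hrec p hp, hrec p' hp']
    have h' : F.blockCoords r p = F.blockCoords r p' := h
    rw [h']
  · have hmap : (affineSpan ℝ (stdSimplex ℝ α ×ˢ stdSimplex ℝ β) : Set ((α → ℝ) × (β → ℝ))) =
        (F.blockCoords r).toAffineMap '' (affineSpan ℝ (F.component r) : Set V) := by
      rw [← AffineSubspace.coe_map, AffineSubspace.map_span, LinearMap.coe_toAffineMap,
        blockCoords_image_component]
    rw [hmap]
    ext z
    constructor
    · rintro ⟨p, ⟨hp, hpL⟩, rfl⟩
      exact ⟨⟨p, hp, rfl⟩, fun i => hL.X_int r i p hpL, fun j => hL.Y_int r j p hpL⟩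
    · rintro ⟨⟨p, hp, rfl⟩, hz⟩
      refine ⟨p, ⟨hp, ?_⟩, rfl⟩
      rw [hrec p hp]
      exact sum_smul_mem_lattice (hL.A_mem r) (hL.B_mem r) hz.1 hz.2

lemma isFoldZJoin {q : ℕ} [Nonempty α] [Nonempty β] {F : JoinFrame V (Fin q) α β}
    {L : AddSubgroup V} (hL : F.IsIntegral L) :
    IsFoldZJoin q L F.polytope ((integerLattice α).prod (integerLattice β))
      (stdSimplex ℝ α ×ˢ stdSimplex ℝ β) :=
  ⟨F.component,
    { isPolytope := fun _ => ⟨_, Set.finite_range _, Set.range_nonempty _, rfl⟩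
      hyperplane := ⟨F.height, fun _ hx => F.height_eq_one hx⟩
      convexHull_eq := F.polytope_eq_convexHull_components
      span_eq := F.span_polytope_eq_iSup
      independent := F.iSupIndep_span_component
      lattice_eq := lattice_eq_iSup hL },
    latticeEquivalent_component hL⟩

end JoinFrame

/-! ### Powers of a permutation with two cycles -/

/-- Two exponents `r + q * i`, with `r < q` and `i < m`, agree modulo `q * m` only if they are
equal. -/
lemma add_mul_modEq_iff {q m : ℕ} (r r' : Fin q) (i i' : Fin m) :
    (r : ℕ) + q * i ≡ r' + q * i' [MOD q * m] ↔ r = r' ∧ i = i' := by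
  have hlt : ∀ (r : Fin q) (i : Fin m), (r : ℕ) + q * i < q * m := by
    intro r i
    calc (r : ℕ) + q * i < q + q * i := by have := r.2; omega
      _ = q * (i + 1) := by ring
      _ ≤ q * m := Nat.mul_le_mul_left q i.2
  constructor
  · intro h
    have h' := Nat.ModEq.eq_of_lt_of_lt h (hlt r i) (hlt r' i')
    have hq : 0 < q := r.pos
    have h1 : (r : ℕ) = r' := by
      have := congrArg (· % q) h'
      simpa [Nat.mod_eq_of_lt r.2, Nat.mod_eq_of_lt r'.2] using this
    have h2 : q * (i : ℕ) = q * i' := by omega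
    exact ⟨Fin.ext h1, Fin.ext (Nat.eq_of_mul_eq_mul_left hq h2)⟩
  · rintro ⟨rfl, rfl⟩
    rfl

/-- The digit `n % q` does not involve `m`, so both cycles share the same first index. -/
lemma modEq_mod_add_mul (n q m : ℕ) : n ≡ n % q + q * (n / q % m) [MOD q * m] := by
  conv_lhs => rw [← Nat.mod_add_div n q]
  exact Nat.ModEq.add_left _ ((Nat.mod_modEq _ _).symm.mul_left' q)

lemma pow_apply_notMem {ι : Type*} {g : Equiv.Perm ι} {S₁ S₂ : Set ι}
    (hfix : ∀ x, x ∉ S₁ → x ∉ S₂ → g x = x) {x : ι} (h₁ : x ∉ S₁) (h₂ : x ∉ S₂) (n : ℕ) :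
    (g ^ n) x = x := by
  rw [Equiv.Perm.coe_pow]
  exact Function.iterate_fixed (hfix x h₁ h₂) n

/-- The continuous functional reading off a matrix entry. -/
def matrixEntry {n : ℕ} (u v : Fin n) : StrongDual ℝ (Matrix (Fin n) (Fin n) ℝ) where
  toLinearMap := Matrix.entryLinearMap ℝ ℝ u v
  cont := (continuous_apply v).comp (continuous_apply u)

lemma matrixEntry_apply {n : ℕ} (u v : Fin n) (M : Matrix (Fin n) (Fin n) ℝ) :
    matrixEntry u v M = M u v := rfl

/-- The frame attached to a product of two disjoint cycles of lengths `q * m` and `q * k` through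
`s₁` and `s₂`: permutation matrices of powers, restricted to the rows outside and inside the second
cycle. -/
def twoCycleFrame {n q m k : ℕ} {g : Equiv.Perm (Fin n)} {S₁ S₂ : Finset (Fin n)}
    (hdisj : Disjoint S₁ S₂) (hcyc₁ : g.IsCycleOn (S₁ : Set (Fin n)))
    (hcyc₂ : g.IsCycleOn (S₂ : Set (Fin n))) (h₁ : S₁.card = q * m) (h₂ : S₂.card = q * k)
    {s₁ s₂ : Fin n} (hs₁ : s₁ ∈ S₁) (hs₂ : s₂ ∈ S₂) :
    JoinFrame (Matrix (Fin n) (Fin n) ℝ) (Fin q) (Fin m) (Fin k) where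
  -- Rows fixed by `g` go into `A`; every vertex has exactly one `A`-summand, so they are counted
  -- once.
  A r i := Matrix.of fun u v =>
    if u ∈ S₂ then 0 else if (g ^ ((r : ℕ) + q * i)) u = v then 1 else 0
  B r j := Matrix.of fun u v =>
    if u ∈ S₂ then (if (g ^ ((r : ℕ) + q * j)) u = v then 1 else 0) else 0
  X r i := matrixEntry s₁ ((g ^ ((r : ℕ) + q * i)) s₁)
  Y r j := matrixEntry s₂ ((g ^ ((r : ℕ) + q * j)) s₂)
  X_A r i r' i' := by
    have hs : s₁ ∉ S₂ := Finset.disjoint_left.1 hdisj hs₁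
    simp only [matrixEntry_apply, Matrix.of_apply, if_neg hs, hcyc₁.pow_apply_eq_pow_apply hs₁, h₁,
      add_mul_modEq_iff, ← ite_and, eq_comm]
  X_B r i r' j := by
    have hs : s₁ ∉ S₂ := Finset.disjoint_left.1 hdisj hs₁
    simp [matrixEntry_apply, hs]
  Y_A r j r' i := by
    simp [matrixEntry_apply, hs₂]
  Y_B r j r' j' := by
    simp only [matrixEntry_apply, Matrix.of_apply, hcyc₂.pow_apply_eq_pow_apply hs₂, h₂, hs₂,
      true_and, add_mul_modEq_iff, ← ite_and, eq_comm]

section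

variable {n q m k : ℕ} {g : Equiv.Perm (Fin n)} {S₁ S₂ : Finset (Fin n)}
    (hdisj : Disjoint S₁ S₂) (hcyc₁ : g.IsCycleOn (S₁ : Set (Fin n)))
    (hcyc₂ : g.IsCycleOn (S₂ : Set (Fin n))) (h₁ : S₁.card = q * m) (h₂ : S₂.card = q * k)
    {s₁ s₂ : Fin n} (hs₁ : s₁ ∈ S₁) (hs₂ : s₂ ∈ S₂)

lemma twoCycleFrame_isIntegral :
    (twoCycleFrame hdisj hcyc₁ hcyc₂ h₁ h₂ hs₁ hs₂).IsIntegral (integerMatrices n) where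
  A_mem r i u v := by
    simp only [twoCycleFrame, Matrix.of_apply]
    split_ifs
    exacts [⟨0, by simp⟩, ⟨1, by simp⟩, ⟨0, by simp⟩]
  B_mem r j u v := by
    simp only [twoCycleFrame, Matrix.of_apply]
    split_ifs
    exacts [⟨1, by simp⟩, ⟨0, by simp⟩, ⟨0, by simp⟩]
  X_int r i p hp := hp _ _
  Y_int r j p hp := hp _ _

lemma twoCycleFrame_vertex (hfix : ∀ x, x ∉ S₁ → x ∉ S₂ → g x = x) {N : ℕ} {r : Fin q} {i : Fin m}
    {j : Fin k} (hi : N ≡ r + q * i [MOD q * m]) (hj : N ≡ r + q * j [MOD q * k]) :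
    (twoCycleFrame hdisj hcyc₁ hcyc₂ h₁ h₂ hs₁ hs₂).vertex (r, i, j) =
      (g ^ N).permMatrix ℝ := by
  ext u v
  have hrhs : (g ^ N).permMatrix ℝ u v = if (g ^ N) u = v then 1 else 0 := by
    simp [PEquiv.toMatrix_apply, Equiv.toPEquiv_apply, eq_comm]
  rw [hrhs]
  simp only [JoinFrame.vertex, twoCycleFrame, Matrix.add_apply, Matrix.of_apply]
  by_cases hu₂ : u ∈ S₂
  · have := (hcyc₂.pow_apply_eq_pow_apply hu₂).2 (h₂ ▸ hj)
    simp [hu₂, this]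
  · by_cases hu₁ : u ∈ S₁
    · have := (hcyc₁.pow_apply_eq_pow_apply hu₁).2 (h₁ ▸ hi)
      simp [hu₂, this]
    · have hN : ∀ N, (g ^ N) u = u := pow_apply_notMem (S₁ := S₁) (S₂ := S₂) hfix hu₁ hu₂
      simp [hu₂, hN]

lemma permutationPolytope_eq_twoCycleFrame (hfix : ∀ x, x ∉ S₁ → x ∉ S₂ → g x = x)
    (hq : q = Nat.gcd (q * m) (q * k)) (hq0 : 0 < q) (hm : 0 < m) (hk : 0 < k) :
    permutationPolytope (Subgroup.zpowers g) =
      (twoCycleFrame hdisj hcyc₁ hcyc₂ h₁ h₂ hs₁ hs₂).polytope := by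
  unfold permutationPolytope JoinFrame.polytope
  congr 1
  ext M
  constructor
  · rintro ⟨σ, hσ, rfl⟩
    -- Finite order allows a natural exponent.
    obtain ⟨N, rfl⟩ := (mem_powers_iff_mem_zpowers (x := g)).2 hσ
    refine ⟨(⟨N % q, Nat.mod_lt _ hq0⟩, ⟨N / q % m, Nat.mod_lt _ hm⟩,
      ⟨N / q % k, Nat.mod_lt _ hk⟩), ?_⟩
    exact twoCycleFrame_vertex hdisj hcyc₁ hcyc₂ h₁ h₂ hs₁ hs₂ hfix (modEq_mod_add_mul N q m)
      (modEq_mod_add_mul N q k)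
  · rintro ⟨⟨r, i, j⟩, rfl⟩
    -- The moduli have gcd `q` and both residues reduce to `r`, which is the solvability condition
    -- for the simultaneous congruences.
    have hmod : (r : ℕ) + q * i ≡ r + q * j [MOD Nat.gcd (q * m) (q * k)] := by
      rw [← hq]
      simp [Nat.ModEq]
    obtain ⟨N, hN₁, hN₂⟩ := Nat.chineseRemainder' hmod
    refine ⟨g ^ N, Subgroup.npow_mem_zpowers g N, ?_⟩
    exact (twoCycleFrame_vertex hdisj hcyc₁ hcyc₂ h₁ h₂ hs₁ hs₂ hfix hN₁ hN₂).symm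

end

/-! ### The theorem -/

theorem mainTheorem2 (n : ℕ) (g : Equiv.Perm (Fin n)) (S₁ S₂ : Finset (Fin n)) (ℓ₁ ℓ₂ q : ℕ)
    (hne₁ : S₁.Nonempty) (hne₂ : S₂.Nonempty) (hdisj : Disjoint S₁ S₂)
    (hcyc₁ : g.IsCycleOn (S₁ : Set (Fin n))) (hcyc₂ : g.IsCycleOn (S₂ : Set (Fin n)))
    (hfix : ∀ x, x ∉ S₁ → x ∉ S₂ → g x = x)
    (hℓ₁ : S₁.card = ℓ₁) (hℓ₂ : S₂.card = ℓ₂) (hq : q = Nat.gcd ℓ₁ ℓ₂) :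
    IsFoldZJoin q (integerMatrices n) (permutationPolytope (Subgroup.zpowers g))
      ((integerLattice (Fin (ℓ₁ / q - 1 + 1))).prod (integerLattice (Fin (ℓ₂ / q - 1 + 1))))
      (unimodularSimplex (ℓ₁ / q - 1) ×ˢ unimodularSimplex (ℓ₂ / q - 1)) ∧
    polytopeDim (permutationPolytope (Subgroup.zpowers g)) = (ℓ₁ : ℤ) + ℓ₂ - q - 1 ∧
    (Set.extremePoints ℝ (permutationPolytope (Subgroup.zpowers g))).ncard = Nat.lcm ℓ₁ ℓ₂ ∧
    (¬ ℓ₁ ∣ ℓ₂ → ¬ ℓ₂ ∣ ℓ₁ →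
      {F | IsFacet (permutationPolytope (Subgroup.zpowers g)) F}.ncard = ℓ₁ + ℓ₂) ∧
    (ℓ₁ ∣ ℓ₂ ∨ ℓ₂ ∣ ℓ₁ →
      {F | IsFacet (permutationPolytope (Subgroup.zpowers g)) F}.ncard = max ℓ₁ ℓ₂) := by
  obtain ⟨s₁, hs₁⟩ := hne₁
  obtain ⟨s₂, hs₂⟩ := hne₂
  have hpos₁ : 0 < ℓ₁ := hℓ₁ ▸ Finset.card_pos.2 ⟨s₁, hs₁⟩
  have hpos₂ : 0 < ℓ₂ := hℓ₂ ▸ Finset.card_pos.2 ⟨s₂, hs₂⟩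
  have hq0 : 0 < q := hq ▸ Nat.gcd_pos_of_pos_left _ hpos₁
  have hd₁ : q ∣ ℓ₁ := hq ▸ Nat.gcd_dvd_left _ _
  have hd₂ : q ∣ ℓ₂ := hq ▸ Nat.gcd_dvd_right _ _
  have hm : ℓ₁ = q * (ℓ₁ / q - 1 + 1) := by
    rw [Nat.sub_add_cancel (Nat.div_pos (Nat.le_of_dvd hpos₁ hd₁) hq0), Nat.mul_div_cancel' hd₁]
  have hk : ℓ₂ = q * (ℓ₂ / q - 1 + 1) := by
    rw [Nat.sub_add_cancel (Nat.div_pos (Nat.le_of_dvd hpos₂ hd₂) hq0), Nat.mul_div_cancel' hd₂]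
  -- From here the quotients are `m + 1` and `k + 1`; thus `m = 0` means `ℓ₁ = q`, that is, `ℓ₁ ∣
  -- ℓ₂`, and similarly for `k`.
  generalize ℓ₁ / q - 1 = m at *
  generalize ℓ₂ / q - 1 = k at *
  have : Nonempty (Fin q) := ⟨⟨0, hq0⟩⟩
  set F := twoCycleFrame hdisj hcyc₁ hcyc₂ (hℓ₁.trans hm) (hℓ₂.trans hk) hs₁ hs₂
  have hP : permutationPolytope (Subgroup.zpowers g) = F.polytope :=
    permutationPolytope_eq_twoCycleFrame hdisj hcyc₁ hcyc₂ _ _ hs₁ hs₂ hfix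
      (by rw [← hm, ← hk, hq]) hq0 m.succ_pos k.succ_pos
  rw [hP]
  refine ⟨JoinFrame.isFoldZJoin (twoCycleFrame_isIntegral _ _ _ _ _ _ _), ?_, ?_, ?_, ?_⟩
  · have := F.finrank_span_polytope
    simp only [Fintype.card_fin, ← hm, ← hk] at this
    rw [F.polytopeDim_subset subset_rfl]
    omega
  · rw [F.ncard_extremePoints]
    simp only [Fintype.card_fin]
    have h := Nat.gcd_mul_lcm ℓ₁ ℓ₂
    rw [← hq] at h
    refine Nat.eq_of_mul_eq_mul_left hq0 (Eq.trans ?_ h.symm)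
    conv_rhs => rw [hm, hk]
    ring
  · intro hn₁ hn₂
    have hm0 : m ≠ 0 := by
      rintro rfl
      exact hn₁ (by rw [hm, zero_add, mul_one]; exact hd₂)
    have hk0 : k ≠ 0 := by
      rintro rfl
      exact hn₂ (by rw [hk, zero_add, mul_one]; exact hd₁)
    have : Nontrivial (Fin (m + 1)) := Fin.nontrivial_iff_two_le.2 (by omega)
    have : Nontrivial (Fin (k + 1)) := Fin.nontrivial_iff_two_le.2 (by omega)
    rw [F.ncard_facets_of_nontrivial]
    simp only [Fintype.card_fin, ← hm, ← hk]
  · rintro (h | h)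
    · rw [max_eq_right (Nat.le_of_dvd hpos₂ h)]
      rw [Nat.gcd_eq_left h] at hq
      have hm0 : m = 0 := by
        have : q * (m + 1) = q * 1 := by rw [← hm, mul_one, hq]
        have := Nat.eq_of_mul_eq_mul_left hq0 this
        omega
      have : Subsingleton (Fin (m + 1)) := Fin.subsingleton_iff_le_one.2 (by omega)
      rw [F.ncard_facets_of_subsingleton]
      simp only [Fintype.card_fin, ← hk]
    · rw [max_eq_left (Nat.le_of_dvd hpos₁ h)]
      rw [Nat.gcd_eq_right h] at hq
      have hk0 : k = 0 := by
        have : q * (k + 1) = q * 1 := by rw [← hk, mul_one, hq]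
        have := Nat.eq_of_mul_eq_mul_left hq0 this
        omega
      have : Subsingleton (Fin (k + 1)) := Fin.subsingleton_iff_le_one.2 (by omega)
      -- The one-point factor is now the second one, so the two factors are exchanged.
      rw [← F.swap_polytope, F.swap.ncard_facets_of_subsingleton]
      simp only [Fintype.card_fin, ← hm]
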